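/- Let $D\subset\mathbb R^d$ be compact with positive Lebesgue measure $|D|>0$ and let $\gamma$ be a constant. There is a constant $a>0$, depending only on $D$ and $\gamma$, such that the following holds. Let $K:D\times D\to\mathbb R$ be a continuous covariance function (symmetric and positive semidefinite) that is not identically zero. For each $n$ let $s_{n,1},\dots,s_{n,n}$ be distinct points of $D$, with Voronoi cells $D_{n,i}=\{x\in D:\ \|x-s_{n,i}\|=\min_j\|x-s_{n,j}\|\}$, such that $$\max_{1\le i\le n}\operatorname{diam}(D_{n,i})\to 0\quad(n\to\infty),\qquad \max_{1\le i\le n}|D_{n,i}|\le\gamma\min_{1\le i\le n}|D_{n,i}|\quad\text{for all } n\ge 1 .$$ Let $V_n=(K(s_{n,i},s_{n,j}))_{i,j=1}^n$ be the kernel matrix and $\lambda_{n,1}\ge\dots\ge\lambda_{n,n}\ge 0$ its eigenvalues. Then: 1. For every sequence of indices $i=i_n\le n$ with $i_n\to\infty$, $\lambda_{n,1}/\lambda_{n,i_n}\to\infty$ as $n\to\infty$ (the ratio is read as $\infty$ if $\lambda_{n,i_n}=0<\lambda_{n,1}$). 2. The kernel matrix becomes ill-conditioned: its spectral condition number $\kappa(V_n)=\|V_n\|\,\|V_n^{-1}\|$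 (read as $\infty$ if $V_n$ is singular) tends to $\infty$. So does the condition number $\kappa(V_n^{-1})$ of the precision matrix, as $n\to\infty$ through those $n$ for which $V_n$ is invertible. 3. The integral operator $\varphi\mapsto\int_D K(\cdot,y)\varphi(y)\,dy$ on $L^2(D)$ has a largest eigenvalue $\lambda_1$, $\lambda_1>0$, and $$\frac{\lambda_{n,1}}{n}\ \ge\ a\,\lambda_1+o(1)\qquad (n\to\infty).$$ -/

import Mathlib

open MeasureTheory Filter Topology
open scoped ENNReal

noncomputable section

/-- A covariance function (positive semidefinite kernel) on a set `X`: `K` is symmetric and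
`∑ᵢ ∑ⱼ cᵢ K(xᵢ, xⱼ) cⱼ ≥ 0` for all finite real linear combinations of points of `X`. -/
def IsCovarianceFunction {X : Type*} (K : X → X → ℝ) : Prop :=
  (Matrix.of K).PosSemidef

/-- The kernel matrix `V_n = (K(s_i, s_j))_{i,j}` at the locations `s_1, …, s_n`. -/
def kernelMatrix {X : Type*} (K : X → X → ℝ) {n : ℕ} (s : Fin n → X) :
    Matrix (Fin n) (Fin n) ℝ :=
  Matrix.of fun i j => K (s i) (s j)

theorem IsCovarianceFunction.isHermitian_kernelMatrix {X : Type*} {K : X → X → ℝ}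
    (hK : IsCovarianceFunction K) {n : ℕ} (s : Fin n → X) : (kernelMatrix K s).IsHermitian :=
  (hK.submatrix s).isHermitian

/-- The `i`-th largest eigenvalue, `1 ≤ i ≤ n`, counted with multiplicity, of a real symmetric
`n × n` matrix (`eigenvalues₀` lists the eigenvalues in decreasing order, starting at index `0`).
The value for `i` outside of `1, …, n` is irrelevant. -/
def ithEigenvalue {n : ℕ} {A : Matrix (Fin n) (Fin n) ℝ} (hA : A.IsHermitian) (i : ℕ) : ℝ :=
  if h : 1 ≤ i ∧ i ≤ n then
    hA.eigenvalues₀ ⟨i - 1, by rw [Fintype.card_fin]; omega⟩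
  else 0

/-- The spectral condition number `‖A‖ ‖A⁻¹‖` (operator norms for the Euclidean norm) of a square
matrix, equal to `∞` if `A` is singular. -/
def conditionNumber {n : ℕ} (A : Matrix (Fin n) (Fin n) ℝ) : ℝ≥0∞ :=
  open Classical in
  if IsUnit A.det then
    ENNReal.ofReal
      (‖Matrix.toEuclideanCLM (n := Fin n) (𝕜 := ℝ) A‖ *
        ‖Matrix.toEuclideanCLM (n := Fin n) (𝕜 := ℝ) A⁻¹‖)
  else ∞

/-- The (closed) Voronoi cell of `s_i` in `X`: the points with
`dist x s_i = min_j dist x s_j`. -/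
def voronoiCell {X : Type*} [MetricSpace X] {n : ℕ} (s : Fin n → X) (i : Fin n) : Set X :=
  {x | ∀ j, dist x (s i) ≤ dist x (s j)}

/-- Lebesgue measure on a subset `D` of `ℝ^d`, as a measure on the type of points of `D`. -/
def lebesgueOn {d : ℕ} (D : Set (EuclideanSpace ℝ (Fin d))) : Measure D :=
  Measure.comap Subtype.val volume

/-- The eigenvalues of the integral operator `φ ↦ ∫_X K(·, y) φ(y) dm(y)` on the real space
`L²(X, m)`. -/
def integralEigenvalues {X : Type*} [MeasurableSpace X] (m : Measure X) (K : X → X → ℝ) : Set ℝ :=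
  {μ | ∃ φ : X → ℝ, MemLp φ 2 m ∧ ¬ φ =ᵐ[m] 0 ∧
    ∀ᵐ x ∂m, ∫ y, K x y * φ y ∂m = μ * φ x}

end

/-!
The matrix `V_n / n` is, up to the weights of the points, a discretization of the integral operator
`T` of `K` on `L²(D)`. This operator is compact (by Arzelà–Ascoli its values on the unit ball are
relatively compact in the space of continuous functions) and symmetric, and its quadratic form is
positive somewhere, so it has a largest eigenvalue `λ₁ > 0`, with a continuous eigenfunction `ψ`
(`exists_isGreatest_integralEigenvalues`). Positivity of the form needs that Lebesgue measure does
not vanish on nonempty open subsets of `D`, although `D` itself may be any compact set of positive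
measure: this is forced by the existence of shrinking Voronoi cells of comparable measures
(`isOpenPosMeasure_of_voronoiCell`).

Testing `V_n` with the vector `cᵢ = |D_{n,i}| ψ(s_{n,i})` turns the quadratic form into a Riemann
sum of `∫∫ K(x, y) ψ(x) ψ(y) = λ₁ ∫ ψ²`. Voronoi cells overlap in null sets only, so the comparable
measures are at most `γ |D| / n`, and `∑ cᵢ²` is at most `γ |D| / n` times a Riemann sum of `∫ ψ²`.
Hence `λ_{n,1} / n ≥ λ₁ / (γ |D|) + o(1)` (`exists_tendsto_le_ithEigenvalue_one_div`).

On the other hand `i λ_{n,i}` is at most the trace of `V_n`, which is at most `n` times the maximum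
of `K` on the diagonal. So `λ_{n,1} / λ_{n,i}` is at least a constant times `i`
(`tendsto_div_ithEigenvalue`), and the case `i = n` bounds the condition number from below.
-/

/-! ### Eigenvalues of symmetric matrices -/

section Matrices

open Matrix

variable {n : ℕ} {A : Matrix (Fin n) (Fin n) ℝ}

theorem ithEigenvalue_of_le (hA : A.IsHermitian) {i : ℕ} (h1 : 1 ≤ i) (hn : i ≤ n) :
    ithEigenvalue hA i = hA.eigenvalues₀ ⟨i - 1, by rw [Fintype.card_fin]; omega⟩ :=
  dif_pos ⟨h1, hn⟩

theorem ithEigenvalue_nonneg (hA : A.PosSemidef) (i : ℕ) : 0 ≤ ithEigenvalue hA.1 i := by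
  unfold ithEigenvalue
  split_ifs with h
  · have := hA.eigenvalues_nonneg (Fintype.equivOfCardEq (Fintype.card_fin _)
      (⟨i - 1, by rw [Fintype.card_fin]; omega⟩ : Fin (Fintype.card (Fin n))))
    simpa [IsHermitian.eigenvalues] using this
  · exact le_rfl

/-- An eigenvector of norm one for the `i`-th largest eigenvalue. -/
theorem exists_eigenvector_ithEigenvalue (hA : A.IsHermitian) {i : ℕ} (h1 : 1 ≤ i) (hn : i ≤ n) :
    ∃ v : EuclideanSpace ℝ (Fin n), ‖v‖ = 1 ∧
      toEuclideanCLM (n := Fin n) (𝕜 := ℝ) A v = ithEigenvalue hA i • v := by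
  let k : Fin (Fintype.card (Fin n)) := ⟨i - 1, by rw [Fintype.card_fin]; omega⟩
  let j : Fin n := Fintype.equivOfCardEq (Fintype.card_fin _) k
  refine ⟨hA.eigenvectorBasis j, hA.eigenvectorBasis.orthonormal.1 j, ?_⟩
  have hj : hA.eigenvalues j = ithEigenvalue hA i := by
    rw [ithEigenvalue_of_le hA h1 hn]
    simp [IsHermitian.eigenvalues, j, k]
  have := hA.mulVec_eigenvectorBasis j
  rw [hj] at this
  apply (WithLp.ofLp_injective 2)
  simpa using this

/-- The largest eigenvalue bounds the quadratic form. -/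
theorem dotProduct_mulVec_le_ithEigenvalue_one (hA : A.IsHermitian) (hn : 1 ≤ n)
    (x : Fin n → ℝ) : x ⬝ᵥ A *ᵥ x ≤ ithEigenvalue hA 1 * (x ⬝ᵥ x) := by
  let b := hA.eigenvectorBasis
  let v : EuclideanSpace ℝ (Fin n) := WithLp.toLp 2 x
  let w : EuclideanSpace ℝ (Fin n) := WithLp.toLp 2 (A *ᵥ x)
  have hle (i : Fin n) : hA.eigenvalues i ≤ ithEigenvalue hA 1 := by
    rw [ithEigenvalue_of_le hA le_rfl hn]
    exact hA.eigenvalues₀_antitone (Fin.mk_le_of_le_val (Nat.zero_le _))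
  have hw (i : Fin n) : inner ℝ (b i) w = hA.eigenvalues i * inner ℝ (b i) v := by
    have h := hA.mulVec_eigenvectorBasis i
    have e1 : inner ℝ (b i) w = (A *ᵥ x) ⬝ᵥ (b i).ofLp := by
      simp [w, EuclideanSpace.inner_eq_star_dotProduct]
    have e2 : inner ℝ (b i) v = x ⬝ᵥ (b i).ofLp := by
      simp [v, EuclideanSpace.inner_eq_star_dotProduct]
    have hT : Aᵀ = A := by simpa [IsHermitian, conjTranspose_eq_transpose_of_trivial] using hA
    rw [e1, e2, dotProduct_comm, dotProduct_mulVec, ← mulVec_transpose, hT, h,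
      smul_dotProduct, smul_eq_mul, dotProduct_comm]
  have e1 : x ⬝ᵥ A *ᵥ x = ∑ i, hA.eigenvalues i * inner ℝ (b i) v ^ 2 := by
    have : x ⬝ᵥ A *ᵥ x = inner ℝ v w := by
      simp [v, w, EuclideanSpace.inner_eq_star_dotProduct, dotProduct_comm]
    rw [this, ← b.sum_inner_mul_inner v w]
    refine Finset.sum_congr rfl fun i _ => ?_
    rw [hw, real_inner_comm]; ring
  have e2 : x ⬝ᵥ x = ∑ i, inner ℝ (b i) v ^ 2 := by
    have : x ⬝ᵥ x = inner ℝ v v := by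
      rw [EuclideanSpace.inner_eq_star_dotProduct]
      simp [v]
    rw [this, ← b.sum_inner_mul_inner v v]
    refine Finset.sum_congr rfl fun i _ => ?_
    rw [real_inner_comm]; ring
  rw [e1, e2, Finset.mul_sum]
  exact Finset.sum_le_sum fun i _ => mul_le_mul_of_nonneg_right (hle i) (sq_nonneg _)

/-- The `i` largest eigenvalues of a positive semidefinite matrix are all at least the `i`-th one
and sum up to at most the trace. -/
theorem mul_ithEigenvalue_le_trace (hA : A.PosSemidef) {i : ℕ} (h1 : 1 ≤ i) (hn : i ≤ n) :
    i * ithEigenvalue hA.1 i ≤ A.trace := by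
  have htr : A.trace = ∑ k, hA.1.eigenvalues₀ k := by
    rw [hA.1.trace_eq_sum_eigenvalues]
    exact Equiv.sum_comp (Fintype.equivOfCardEq (Fintype.card_fin _)).symm hA.1.eigenvalues₀
  have hnn (k) : 0 ≤ hA.1.eigenvalues₀ k := by
    simpa [IsHermitian.eigenvalues] using
      hA.eigenvalues_nonneg (Fintype.equivOfCardEq (Fintype.card_fin _) k)
  rw [htr, ithEigenvalue_of_le hA.1 h1 hn]
  set k : Fin (Fintype.card (Fin n)) := ⟨i - 1, by rw [Fintype.card_fin]; omega⟩
  have hcard : (Finset.Iic k).card = i := by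
    rw [Fin.card_Iic]; simp only [k]; omega
  calc (i : ℝ) * hA.1.eigenvalues₀ k = (Finset.Iic k).card • hA.1.eigenvalues₀ k := by
        rw [hcard, nsmul_eq_mul]
    _ ≤ ∑ l ∈ Finset.Iic k, hA.1.eigenvalues₀ l :=
        Finset.card_nsmul_le_sum _ _ _ fun l hl =>
          hA.1.eigenvalues₀_antitone (Finset.mem_Iic.1 hl)
    _ ≤ ∑ l, hA.1.eigenvalues₀ l :=
        Finset.sum_le_sum_of_subset_of_nonneg (Finset.subset_univ _) fun l _ _ => hnn l

/-- The condition number of a positive semidefinite matrix is at least the ratio of its extreme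
eigenvalues. -/
theorem div_ithEigenvalue_le_conditionNumber (hA : A.PosSemidef) (hn : 1 ≤ n) :
    ENNReal.ofReal (ithEigenvalue hA.1 1) / ENNReal.ofReal (ithEigenvalue hA.1 n) ≤
      conditionNumber A := by
  unfold conditionNumber
  split_ifs with hdet
  swap
  · exact le_top
  obtain ⟨v, hv, hAv⟩ := exists_eigenvector_ithEigenvalue hA.1 le_rfl hn
  obtain ⟨u, hu, hAu⟩ := exists_eigenvector_ithEigenvalue hA.1 hn le_rfl
  have h1 : ithEigenvalue hA.1 1 ≤ ‖toEuclideanCLM (n := Fin n) (𝕜 := ℝ) A‖ := by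
    have := (toEuclideanCLM (n := Fin n) (𝕜 := ℝ) A).le_opNorm v
    rw [hAv, norm_smul, hv, mul_one, mul_one] at this
    exact (le_abs_self _).trans this
  have hinv : toEuclideanCLM (n := Fin n) (𝕜 := ℝ) A⁻¹
      (toEuclideanCLM (n := Fin n) (𝕜 := ℝ) A u) = u := by
    rw [← mul_apply_eq_comp, ← map_mul, nonsing_inv_mul _ hdet, map_one,
      one_apply_eq_self]
  have h0 := ithEigenvalue_nonneg hA n
  have h2 : 1 ≤ ‖toEuclideanCLM (n := Fin n) (𝕜 := ℝ) A⁻¹‖ * ithEigenvalue hA.1 n := by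
    have := (toEuclideanCLM (n := Fin n) (𝕜 := ℝ) A⁻¹).le_opNorm
      (toEuclideanCLM (n := Fin n) (𝕜 := ℝ) A u)
    rwa [hinv, hAu, norm_smul, hu, mul_one, Real.norm_of_nonneg h0] at this
  have hpos : 0 < ithEigenvalue hA.1 n := by
    refine h0.lt_of_ne fun h => ?_
    rw [← h, mul_zero] at h2
    linarith
  rw [← ENNReal.ofReal_div_of_pos hpos]
  refine ENNReal.ofReal_le_ofReal ?_
  rw [div_le_iff₀ hpos, mul_assoc]
  calc _ ≤ ‖toEuclideanCLM (n := Fin n) (𝕜 := ℝ) A‖ * 1 := by rwa [mul_one]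
    _ ≤ _ := by gcongr

theorem conditionNumber_inv (h : IsUnit A.det) : conditionNumber A⁻¹ = conditionNumber A := by
  unfold conditionNumber
  rw [if_pos h, if_pos (isUnit_nonsing_inv_det A h), nonsing_inv_nonsing_inv A h, mul_comm]

end Matrices

/-! ### Compact operators on Hilbert spaces -/

section CompactOperators

variable {H : Type*} [NormedAddCommGroup H] [InnerProductSpace ℝ H]

/-- A compact symmetric operator `T` whose quadratic form is positive somewhere has a largest
eigenvalue, and it is positive. With `S = T + ‖T‖`, a positive operator, `‖S‖` is the supremum of
the Rayleigh quotient of `S`, hence belongs to the spectrum of `S`; so `‖S‖ - ‖T‖` belongs to the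
spectrum of `T`. -/
theorem IsCompactOperator.exists_isGreatest_hasEigenvalue [CompleteSpace H] {T : H →L[ℝ] H}
    (hT : IsCompactOperator T) (hsymm : T.IsSymmetric) (hpos : ∃ x, 0 < inner ℝ (T x) x) :
    ∃ μ : ℝ, 0 < μ ∧ Module.End.HasEigenvalue (T : Module.End ℝ H) μ ∧
      ∀ ν, Module.End.HasEigenvalue (T : Module.End ℝ H) ν → ν ≤ μ := by
  obtain ⟨x₀, hx₀⟩ := hpos
  have hx₀0 : x₀ ≠ 0 := by rintro rfl; simp at hx₀
  have : Nontrivial H := ⟨x₀, 0, hx₀0⟩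
  let S : H →L[ℝ] H := T + algebraMap ℝ (H →L[ℝ] H) ‖T‖
  have hScoe (x : H) : S x = T x + ‖T‖ • x := by simp [S, Algebra.algebraMap_eq_smul_one]
  have hR (x : H) (hx : x ≠ 0) : S.rayleighQuotient x = T.rayleighQuotient x + ‖T‖ := by
    have : 0 < ‖x‖ ^ 2 := by positivity
    simp only [ContinuousLinearMap.rayleighQuotient, ContinuousLinearMap.reApplyInnerSelf_apply,
      hScoe, inner_add_left, real_inner_smul_left, real_inner_self_eq_norm_sq, RCLike.re_to_real]
    field_simp
  have hRnn (x : H) : 0 ≤ S.rayleighQuotient x := by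
    by_cases hx : x = 0
    · simp [hx]
    · rw [hR x hx]
      linarith [neg_abs_le (T.rayleighQuotient x), T.rayleighQuotient_le_norm x]
  have hSsymm : S.IsSymmetric := fun x y => by
    have := hsymm x y
    simp only [ContinuousLinearMap.coe_coe] at this ⊢
    rw [hScoe, hScoe, inner_add_left, inner_add_right, this, real_inner_smul_left,
      real_inner_smul_right]
  have hnorm : ‖S‖ = ⨆ x, S.rayleighQuotient x := by
    rw [S.norm_eq_iSup_rayleighQuotient hSsymm]
    simp_rw [abs_of_nonneg (hRnn _)]
  have hle (x : H) : S.rayleighQuotient x ≤ ‖S‖ :=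
    (le_abs_self _).trans (S.rayleighQuotient_le_norm x)
  have hspecS : ‖S‖ ∈ spectrum ℝ S := by
    by_contra h
    obtain ⟨ε, hε, hb⟩ := S.rayleighQuotient_le_of_norm_mem_resolventSet
      (by simpa [spectrum] using h)
    have : ‖S‖ ≤ ‖S‖ - ε := by
      conv_lhs => rw [hnorm]
      exact ciSup_le hb
    linarith
  have hpos : 0 < ‖S‖ - ‖T‖ := by
    have h1 := hle x₀
    rw [hR x₀ hx₀0] at h1
    have : 0 < T.rayleighQuotient x₀ := by
      have : 0 < ‖x₀‖ ^ 2 := by positivity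
      simp only [ContinuousLinearMap.rayleighQuotient, ContinuousLinearMap.reApplyInnerSelf_apply,
        RCLike.re_to_real]
      positivity
    linarith
  refine ⟨‖S‖ - ‖T‖, hpos, ?_, fun ν hν => ?_⟩
  · rw [hT.hasEigenvalue_iff_mem_spectrum hpos.ne']
    have := spectrum.add_mem_add_iff (R := ℝ) (a := T) (r := ‖S‖ - ‖T‖) (s := ‖T‖)
    rw [← this]
    simpa [S, add_comm] using hspecS
  · obtain ⟨x, hx, hx0⟩ := hν.exists_hasEigenvector
    rw [Module.End.mem_eigenspace_iff] at hx
    have hTx : T x = ν • x := hx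
    have h := hle x
    rw [hR x hx0] at h
    have : T.rayleighQuotient x = ν := by
      have : ‖x‖ ^ 2 ≠ 0 := by positivity
      simp only [ContinuousLinearMap.rayleighQuotient,
        ContinuousLinearMap.reApplyInnerSelf_apply, hTx, real_inner_smul_left,
        real_inner_self_eq_norm_sq, RCLike.re_to_real]
      field_simp
    linarith

variable {X : Type*} [TopologicalSpace X] [CompactSpace X]

/-- The operator `φ ↦ (x ↦ ⟪k x, φ⟫)` from a Hilbert space to the space of bounded continuous
functions defined by a continuous family of vectors `k`. -/
noncomputable def innerFamily (k : C(X, H)) : H →L[ℝ] BoundedContinuousFunction X ℝ :=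
  LinearMap.mkContinuous
    { toFun := fun φ => BoundedContinuousFunction.mkOfCompact
        ⟨fun x => inner ℝ (k x) φ, by fun_prop⟩
      map_add' := fun φ ψ => by ext x; simp [inner_add_right]
      map_smul' := fun c φ => by ext x; simp [real_inner_smul_right] }
    ‖k‖ fun φ => by
      rw [BoundedContinuousFunction.norm_le (by positivity)]
      intro x
      exact (norm_inner_le_norm _ _).trans (by gcongr; exact k.norm_coe_le_norm x)

@[simp]
theorem innerFamily_apply (k : C(X, H)) (φ : H) (x : X) :
    innerFamily k φ x = inner ℝ (k x) φ := rfl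

theorem isCompactOperator_innerFamily (k : C(X, H)) : IsCompactOperator (innerFamily k) := by
  refine (isCompactOperator_iff_isCompact_closure_image_closedBall (innerFamily k).toLinearMap
    one_pos).2 ?_
  refine BoundedContinuousFunction.arzela_ascoli (Metric.closedBall (0 : ℝ) ‖k‖)
    (isCompact_closedBall _ _) _ ?_ ?_
  · rintro _ x ⟨φ, hφ, rfl⟩
    rw [mem_closedBall_zero_iff] at hφ ⊢
    calc ‖inner ℝ (k x) φ‖ ≤ ‖k x‖ * ‖φ‖ := norm_inner_le_norm _ _
      _ ≤ ‖k‖ * 1 := by gcongr; exact k.norm_coe_le_norm x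
      _ = ‖k‖ := mul_one _
  · intro x₀
    rw [Metric.equicontinuousAt_iff_right]
    intro ε hε
    filter_upwards [Metric.tendsto_nhds.1 k.continuous.continuousAt ε hε] with x hx
    rintro ⟨_, φ, hφ, rfl⟩
    rw [mem_closedBall_zero_iff] at hφ
    change dist (inner ℝ (k x₀) φ) (inner ℝ (k x) φ) < ε
    rw [dist_eq_norm, ← inner_sub_left]
    calc ‖inner ℝ (k x₀ - k x) φ‖ ≤ ‖k x₀ - k x‖ * ‖φ‖ := norm_inner_le_norm _ _
      _ ≤ ‖k x₀ - k x‖ * 1 := by gcongr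
      _ < ε := by rwa [mul_one, ← dist_eq_norm, dist_comm]

end CompactOperators

/-! ### Integral operators with continuous kernels -/

section IntegralOperators

variable {X : Type*} [MetricSpace X] [CompactSpace X] [MeasurableSpace X] [BorelSpace X]
  {m : Measure X} [IsFiniteMeasure m]

/-- The continuous family of vectors `K(x, ·)` of `L²(X, m)`. -/
noncomputable def kernelSection (m : Measure X) [IsFiniteMeasure m] (K : C(X × X, ℝ)) :
    C(X, Lp ℝ 2 m) :=
  ⟨fun x => ContinuousMap.toLp 2 m ℝ (K.curry x), by fun_prop⟩

theorem inner_kernelSection (K : C(X × X, ℝ)) (x : X) (φ : Lp ℝ 2 m) :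
    inner ℝ (kernelSection m K x) φ = ∫ y, K (x, y) * φ y ∂m := by
  rw [L2.inner_def]
  refine integral_congr_ae ?_
  filter_upwards [ContinuousMap.coeFn_toLp (p := 2) (𝕜 := ℝ) m (K.curry x)] with y hy
  simp only [kernelSection, ContinuousMap.coe_mk]
  rw [hy]
  simp [mul_comm]

/-- The integral operator `φ ↦ ∫ K(·, y) φ(y) dm(y)` of `L²(X, m)` for a continuous kernel `K`. -/
noncomputable def integralOperator (m : Measure X) [IsFiniteMeasure m] (K : C(X × X, ℝ)) :
    Lp ℝ 2 m →L[ℝ] Lp ℝ 2 m :=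
  (BoundedContinuousFunction.toLp 2 m ℝ) ∘L (innerFamily (kernelSection m K))

theorem isCompactOperator_integralOperator (K : C(X × X, ℝ)) :
    IsCompactOperator (integralOperator m K) :=
  (isCompactOperator_innerFamily (kernelSection m K)).clm_comp
    (BoundedContinuousFunction.toLp 2 m ℝ : BoundedContinuousFunction X ℝ →L[ℝ] Lp ℝ 2 m)

theorem coeFn_integralOperator (K : C(X × X, ℝ)) (φ : Lp ℝ 2 m) :
    integralOperator m K φ =ᵐ[m] fun x => ∫ y, K (x, y) * φ y ∂m := by
  filter_upwards [BoundedContinuousFunction.coeFn_toLp (p := 2) (𝕜 := ℝ) m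
    (innerFamily (kernelSection m K) φ)] with x hx
  rw [← inner_kernelSection]
  exact hx

theorem inner_integralOperator (K : C(X × X, ℝ)) (φ ψ : Lp ℝ 2 m) :
    inner ℝ (integralOperator m K φ) ψ = ∫ x, ∫ y, K (x, y) * φ y * ψ x ∂m ∂m := by
  rw [L2.inner_def]
  refine integral_congr_ae ?_
  filter_upwards [coeFn_integralOperator K φ] with x hx
  simp only [integral_mul_const]
  rw [hx]
  simp [mul_comm]

theorem isSymmetric_integralOperator {K : C(X × X, ℝ)} (hK : ∀ x y, K (x, y) = K (y, x)) :
    (integralOperator m K).IsSymmetric := by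
  intro φ ψ
  simp only [ContinuousLinearMap.coe_coe]
  rw [← real_inner_comm φ (integralOperator m K ψ), inner_integralOperator,
    inner_integralOperator, integral_integral_swap]
  · refine integral_congr_ae (.of_forall fun y => integral_congr_ae (.of_forall fun x => ?_))
    simp only
    rw [hK y x]; ring
  · have h1 : Integrable (fun p : X × X => ψ p.1 * φ p.2) (m.prod m) :=
      ((Lp.memLp ψ).integrable (by norm_num)).mul_prod ((Lp.memLp φ).integrable (by norm_num))
    have h2 := h1.bdd_mul (c := ‖K‖) (f := fun p => K p) K.continuous.aestronglyMeasurable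
      (.of_forall K.norm_coe_le_norm)
    refine h2.congr (.of_forall fun p => ?_)
    simp only [Function.uncurry]
    ring

theorem exists_inner_integralOperator_pos [m.IsOpenPosMeasure] {K : C(X × X, ℝ)}
    (hK : ∃ x, 0 < K (x, x)) : ∃ φ, 0 < inner ℝ (integralOperator m K φ) φ := by
  obtain ⟨x₀, hx₀⟩ := hK
  have hev : ∀ᶠ p : X × X in 𝓝 x₀ ×ˢ 𝓝 x₀, K (x₀, x₀) / 2 < K (p.1, p.2) := by
    rw [← nhds_prod_eq]
    exact K.continuous.continuousAt.eventually (lt_mem_nhds (half_lt_self hx₀))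
  -- the test function is the indicator of a neighbourhood `U` of `x₀` with `K` bounded below on
  -- `U × U`
  obtain ⟨V, hV, hVK⟩ :=
    (eventually_prod_self_iff (r := fun x y => K (x₀, x₀) / 2 < K (x, y))).1 hev
  obtain ⟨U, hUV, hUo, hxU⟩ := mem_nhds_iff.1 hV
  have hUm := hUo.measurableSet
  have hUpos : 0 < m.real U :=
    ENNReal.toReal_pos (hUo.measure_pos m ⟨x₀, hxU⟩).ne' (measure_ne_top _ _)
  set φ : Lp ℝ 2 m := indicatorConstLp 2 hUm (measure_ne_top m U) (1 : ℝ)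
  refine ⟨φ, ?_⟩
  have hφ : φ =ᵐ[m] U.indicator fun _ => (1 : ℝ) := indicatorConstLp_coeFn
  have hinner (x : X) : ∫ y, K (x, y) * φ y ∂m = ∫ y in U, K (x, y) ∂m := by
    rw [← integral_indicator hUm]
    refine integral_congr_ae ?_
    filter_upwards [hφ] with y hy
    rw [hy]
    by_cases h : y ∈ U <;> simp [h]
  have hcont : Continuous fun x => ∫ y in U, K (x, y) ∂m := by
    have : (fun x => ∫ y in U, K (x, y) ∂m) = innerFamily (kernelSection m K) φ := by
      ext x
      rw [innerFamily_apply, inner_kernelSection, hinner]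
    rw [this]
    exact (innerFamily (kernelSection m K) φ).continuous
  have hint {f : X → ℝ} (hf : Continuous f) : IntegrableOn f U m :=
    (hf.integrable_of_hasCompactSupport
      (HasCompactSupport.of_compactSpace f)).integrableOn
  have houter : inner ℝ (integralOperator m K φ) φ = ∫ x in U, ∫ y in U, K (x, y) ∂m ∂m := by
    rw [inner_integralOperator, ← integral_indicator hUm]
    refine integral_congr_ae ?_
    filter_upwards [hφ] with x hx
    rw [integral_mul_const, hinner, hx]
    by_cases h : x ∈ U <;> simp [h]
  have hin {x : X} (hx : x ∈ U) : K (x₀, x₀) / 2 * m.real U ≤ ∫ y in U, K (x, y) ∂m :=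
    setIntegral_ge_of_const_le_real hUm (measure_ne_top _ _)
      (fun y hy => (hVK x (hUV hx) y (hUV hy)).le) (hint (by fun_prop))
  rw [houter]
  calc (0 : ℝ) < K (x₀, x₀) / 2 * m.real U * m.real U := by positivity
    _ ≤ _ := setIntegral_ge_of_const_le_real hUm (measure_ne_top _ _)
      (fun x hx => hin hx) (hint hcont)

theorem mem_integralEigenvalues_iff {K : C(X × X, ℝ)} {μ : ℝ} :
    μ ∈ integralEigenvalues m (fun x y => K (x, y)) ↔
      Module.End.HasEigenvalue (integralOperator m K : Module.End ℝ (Lp ℝ 2 m)) μ := by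
  constructor
  · rintro ⟨φ, hφ, hφ0, h⟩
    refine Module.End.hasEigenvalue_of_hasEigenvector (x := hφ.toLp φ) ⟨?_, ?_⟩
    · rw [Module.End.mem_eigenspace_iff]
      refine Lp.ext ?_
      filter_upwards [coeFn_integralOperator K (hφ.toLp φ), Lp.coeFn_smul μ (hφ.toLp φ),
        hφ.coeFn_toLp, h] with x h1 h2 h3 h4
      rw [h2, Pi.smul_apply, h3, smul_eq_mul, ← h4]
      refine h1.trans (integral_congr_ae ?_)
      filter_upwards [hφ.coeFn_toLp] with y hy
      rw [hy]
    · exact fun h0 => hφ0 (hφ.coeFn_toLp.symm.trans (Lp.eq_zero_iff_ae_eq_zero.1 h0))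
  · intro h
    obtain ⟨φ, hφ, hφ0⟩ := h.exists_hasEigenvector
    rw [Module.End.mem_eigenspace_iff] at hφ
    refine ⟨φ, Lp.memLp φ, fun h => hφ0 (Lp.eq_zero_iff_ae_eq_zero.2 h), ?_⟩
    have hφ' : integralOperator m K φ = μ • φ := hφ
    filter_upwards [coeFn_integralOperator K φ, Lp.coeFn_smul μ φ] with x h1 h2
    rw [← h1, hφ', h2]
    rfl

/-- The integral operator of a symmetric continuous kernel which is positive somewhere on the
diagonal has a largest eigenvalue, which is positive and has a continuous eigenfunction. -/
theorem exists_isGreatest_integralEigenvalues [m.IsOpenPosMeasure] {K : C(X × X, ℝ)}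
    (hsymm : ∀ x y, K (x, y) = K (y, x)) (hpos : ∃ x, 0 < K (x, x)) :
    ∃ lam : ℝ, 0 < lam ∧ IsGreatest (integralEigenvalues m (fun x y => K (x, y))) lam ∧
      ∃ ψ : X → ℝ, Continuous ψ ∧ 0 < ∫ x, ψ x ^ 2 ∂m ∧
        ∀ x, ∫ y, K (x, y) * ψ y ∂m = lam * ψ x := by
  obtain ⟨lam, hlam, hev, hub⟩ :=
    (isCompactOperator_integralOperator (m := m) K).exists_isGreatest_hasEigenvalue
      (isSymmetric_integralOperator hsymm) (exists_inner_integralOperator_pos hpos)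
  refine ⟨lam, hlam, ⟨mem_integralEigenvalues_iff.2 hev,
    fun ν hν => hub ν (mem_integralEigenvalues_iff.1 hν)⟩, ?_⟩
  obtain ⟨φ, hφ, hφ0⟩ := hev.exists_hasEigenvector
  rw [Module.End.mem_eigenspace_iff] at hφ
  -- the image of an eigenvector in the space of continuous functions
  set ψ := innerFamily (kernelSection m K) φ
  have hψ : BoundedContinuousFunction.toLp 2 m ℝ ψ = lam • φ := hφ
  have hae := BoundedContinuousFunction.coeFn_toLp (p := 2) (𝕜 := ℝ) m ψ
  refine ⟨ψ, ψ.continuous, ?_, fun x => ?_⟩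
  · have h1 : ∫ x, ψ x ^ 2 ∂m = ‖lam • φ‖ ^ 2 := by
      rw [← hψ, ← real_inner_self_eq_norm_sq, L2.inner_def]
      refine integral_congr_ae ?_
      filter_upwards [hae] with x hx
      rw [hx]
      simp
    rw [h1]
    have : lam • φ ≠ 0 := smul_ne_zero hlam.ne' hφ0
    positivity
  · have h2 : ∫ y, K (x, y) * ψ y ∂m = innerFamily (kernelSection m K) (lam • φ) x := by
      rw [innerFamily_apply, inner_kernelSection, ← hψ]
      refine integral_congr_ae ?_
      filter_upwards [hae] with y hy
      rw [hy]
    rw [h2, map_smul]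
    rfl

end IntegralOperators

/-! ### Voronoi cells and Riemann sums -/

section VoronoiCells

variable {X : Type*} [MetricSpace X] {n : ℕ}

theorem isClosed_voronoiCell (s : Fin n → X) (i : Fin n) : IsClosed (voronoiCell s i) := by
  simp only [voronoiCell, Set.ofPred_forall]
  exact isClosed_iInter fun j => isClosed_le (by fun_prop) (by fun_prop)

theorem mem_voronoiCell_self (s : Fin n → X) (i : Fin n) : s i ∈ voronoiCell s i := fun j => by
  rw [dist_self]
  exact dist_nonneg

theorem iUnion_voronoiCell (hn : 1 ≤ n) (s : Fin n → X) : ⋃ i, voronoiCell s i = Set.univ := by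
  have : Nonempty (Fin n) := ⟨⟨0, hn⟩⟩
  refine Set.eq_univ_of_forall fun x => ?_
  obtain ⟨i, hi⟩ := Finite.exists_min fun j => dist x (s j)
  exact Set.mem_iUnion.2 ⟨i, hi⟩

theorem eventually_diam_voronoiCell_lt {s : ∀ n : ℕ, Fin n → X}
    (hmesh : Tendsto (fun n => ⨆ i : Fin n, Metric.diam (voronoiCell (s n) i)) atTop (𝓝 0))
    {δ : ℝ} (hδ : 0 < δ) : ∀ᶠ n in atTop, ∀ i, Metric.diam (voronoiCell (s n) i) < δ := by
  filter_upwards [hmesh.eventually (gt_mem_nhds hδ)] with n hn i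
  exact (le_ciSup (f := fun i : Fin n => Metric.diam (voronoiCell (s n) i))
    (Set.finite_range _).bddAbove i).trans_lt hn

variable [CompactSpace X] [MeasurableSpace X] [BorelSpace X] {m : Measure X} [IsFiniteMeasure m]

theorem integral_eq_sum_voronoiCell (hn : 1 ≤ n) {s : Fin n → X}
    (hdisj : Pairwise (Function.onFun (AEDisjoint m) (voronoiCell s))) {g : X → ℝ}
    (hg : Continuous g) : ∫ x, g x ∂m = ∑ i, ∫ x in voronoiCell s i, g x ∂m := by
  have hint : Integrable g m := hg.integrable_of_hasCompactSupport (.of_compactSpace g)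
  have := integral_iUnion_ae
    (fun i => (isClosed_voronoiCell s i).measurableSet.nullMeasurableSet) hdisj hint.integrableOn
  rwa [iUnion_voronoiCell hn, setIntegral_univ, tsum_fintype] at this

theorem sum_measureReal_voronoiCell (hn : 1 ≤ n) {s : Fin n → X}
    (hdisj : Pairwise (Function.onFun (AEDisjoint m) (voronoiCell s))) :
    ∑ i, m.real (voronoiCell s i) = m.real Set.univ := by
  have := integral_eq_sum_voronoiCell hn hdisj (continuous_const (y := (1 : ℝ)))
  simpa using this.symm

theorem abs_sum_voronoiCell_sub_integral_le (hn : 1 ≤ n) {s : Fin n → X}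
    (hdisj : Pairwise (Function.onFun (AEDisjoint m) (voronoiCell s))) {g : X → ℝ}
    (hg : Continuous g) {δ ε : ℝ} (hdiam : ∀ i, Metric.diam (voronoiCell s i) < δ)
    (hε : ∀ x y, dist x y < δ → |g x - g y| ≤ ε) :
    |∑ i, m.real (voronoiCell s i) * g (s i) - ∫ x, g x ∂m| ≤ ε * m.real Set.univ := by
  rw [integral_eq_sum_voronoiCell hn hdisj hg, ← Finset.sum_sub_distrib,
    ← sum_measureReal_voronoiCell hn hdisj, Finset.mul_sum]
  refine (Finset.abs_sum_le_sum_abs _ _).trans (Finset.sum_le_sum fun i _ => ?_)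
  have hint : IntegrableOn g (voronoiCell s i) m :=
    (hg.integrable_of_hasCompactSupport (.of_compactSpace g)).integrableOn
  have : m.real (voronoiCell s i) * g (s i) - ∫ x in voronoiCell s i, g x ∂m =
      ∫ x in voronoiCell s i, (g (s i) - g x) ∂m := by
    rw [integral_sub (integrable_const _) hint, setIntegral_const, smul_eq_mul]
  rw [this, ← Real.norm_eq_abs]
  refine norm_setIntegral_le_of_norm_le_const (measure_lt_top _ _) fun x hx => hε _ _ ?_
  exact (Metric.dist_le_diam_of_mem Metric.isBounded_of_compactSpace
    (mem_voronoiCell_self s i) hx).trans_lt (hdiam i)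

variable {s : ∀ n : ℕ, Fin n → X}

/-- Riemann sums over Voronoi cells of vanishing diameter converge, uniformly with respect to a
parameter in a compact space. -/
theorem eventually_abs_sum_voronoiCell_sub_integral_le {Y : Type*} [MetricSpace Y]
    [CompactSpace Y]
    (hmesh : Tendsto (fun n => ⨆ i : Fin n, Metric.diam (voronoiCell (s n) i)) atTop (𝓝 0))
    (hdisj : ∀ n, Pairwise (Function.onFun (AEDisjoint m) (voronoiCell (s n))))
    {G : Y × X → ℝ} (hG : Continuous G) {ε : ℝ} (hε : 0 < ε) :
    ∀ᶠ n in atTop, ∀ y,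
      |∑ i, m.real (voronoiCell (s n) i) * G (y, s n i) - ∫ x, G (y, x) ∂m| ≤ ε := by
  set ε' := ε / (m.real Set.univ + 1)
  have hM : 0 < m.real Set.univ + 1 := by positivity
  have hε' : 0 < ε' := by positivity
  obtain ⟨δ, hδ, h⟩ := Metric.uniformContinuous_iff.1
    (CompactSpace.uniformContinuous_of_continuous hG) ε' hε'
  filter_upwards [eventually_diam_voronoiCell_lt hmesh hδ, eventually_ge_atTop 1] with n hd hn y
  refine (abs_sum_voronoiCell_sub_integral_le hn (hdisj n) (g := fun x => G (y, x))
    (by fun_prop) (ε := ε') hd fun a b hab => ?_).trans ?_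
  · have := h (a := (y, a)) (b := (y, b)) (by simpa [Prod.dist_eq] using hab)
    exact this.le
  · calc ε' * m.real Set.univ ≤ ε' * (m.real Set.univ + 1) := by gcongr; linarith
      _ = ε := div_mul_cancel₀ _ hM.ne'

theorem tendsto_sum_voronoiCell
    (hmesh : Tendsto (fun n => ⨆ i : Fin n, Metric.diam (voronoiCell (s n) i)) atTop (𝓝 0))
    (hdisj : ∀ n, Pairwise (Function.onFun (AEDisjoint m) (voronoiCell (s n))))
    {g : X → ℝ} (hg : Continuous g) :
    Tendsto (fun n => ∑ i, m.real (voronoiCell (s n) i) * g (s n i)) atTop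
      (𝓝 (∫ x, g x ∂m)) := by
  rw [Metric.tendsto_nhds]
  intro ε hε
  filter_upwards [eventually_abs_sum_voronoiCell_sub_integral_le (Y := Unit) hmesh hdisj
    (G := fun p => g p.2) (by fun_prop) (half_pos hε)] with n hn
  exact (hn ()).trans_lt (half_lt_self hε)

variable {γ : ℝ}

/-- If the Voronoi cells shrink and have comparable measures, each nonempty open set has positive
measure: it contains one of the cells, and none of these is a null set. -/
theorem isOpenPosMeasure_of_voronoiCell (hm : 0 < m.real Set.univ)
    (hmesh : Tendsto (fun n => ⨆ i : Fin n, Metric.diam (voronoiCell (s n) i)) atTop (𝓝 0))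
    (hdisj : ∀ n, Pairwise (Function.onFun (AEDisjoint m) (voronoiCell (s n))))
    (hratio : ∀ (n : ℕ) (i j : Fin n),
      m.real (voronoiCell (s n) i) ≤ γ * m.real (voronoiCell (s n) j)) :
    m.IsOpenPosMeasure := by
  refine ⟨fun U hU ⟨x, hx⟩ hU0 => ?_⟩
  obtain ⟨δ, hδ, hball⟩ := Metric.isOpen_iff.1 hU x hx
  obtain ⟨n, hd, hn⟩ :=
    ((eventually_diam_voronoiCell_lt hmesh hδ).and (eventually_ge_atTop 1)).exists
  obtain ⟨i, hi⟩ := Set.mem_iUnion.1 ((iUnion_voronoiCell hn (s n)).symm ▸ Set.mem_univ x)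
  have hsub : voronoiCell (s n) i ⊆ U := fun y hy => hball <|
    (Metric.dist_le_diam_of_mem Metric.isBounded_of_compactSpace hy hi).trans_lt (hd i)
  have h0 : m.real (voronoiCell (s n) i) = 0 := by
    rw [measureReal_def, measure_mono_null hsub hU0, ENNReal.toReal_zero]
  have : m.real Set.univ ≤ 0 := by
    rw [← sum_measureReal_voronoiCell hn (hdisj n)]
    refine Finset.sum_nonpos fun j _ => (hratio n j i).trans ?_
    rw [h0, mul_zero]
  linarith

open Matrix in
/-- The quadratic form of the kernel matrix at `cᵢ = |Dᵢ| ψ(sᵢ)` is a Riemann sum of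
`∫∫ K(x, y) ψ(x) ψ(y) = lam ∫ ψ²`, while `∑ cᵢ²` is at most `γ m(X) / n` times a Riemann sum of
`∫ ψ²`, since each cell has measure at most `γ m(X) / n`. -/
theorem exists_tendsto_le_ithEigenvalue_one_div {K : X → X → ℝ} (hK : IsCovarianceFunction K)
    (hKc : Continuous fun p : X × X => K p.1 p.2) (hm : 0 < m.real Set.univ) (hγ : 0 < γ)
    (hmesh : Tendsto (fun n => ⨆ i : Fin n, Metric.diam (voronoiCell (s n) i)) atTop (𝓝 0))
    (hdisj : ∀ n, Pairwise (Function.onFun (AEDisjoint m) (voronoiCell (s n))))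
    (hratio : ∀ (n : ℕ) (i j : Fin n),
      m.real (voronoiCell (s n) i) ≤ γ * m.real (voronoiCell (s n) j))
    {lam : ℝ} {ψ : X → ℝ} (hψ : Continuous ψ) (hψ0 : 0 < ∫ x, ψ x ^ 2 ∂m)
    (heig : ∀ x, ∫ y, K x y * ψ y ∂m = lam * ψ x) :
    ∃ b : ℕ → ℝ, Tendsto b atTop (𝓝 (1 / (γ * m.real Set.univ) * lam)) ∧
      ∀ᶠ n in atTop, b n ≤ ithEigenvalue (hK.isHermitian_kernelMatrix (s n)) 1 / n := by
  let w (n : ℕ) (i : Fin n) : ℝ := m.real (voronoiCell (s n) i)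
  have hw (n : ℕ) (i : Fin n) : 0 ≤ w n i := measureReal_nonneg
  let P (n : ℕ) : ℝ := ∑ i, w n i * ψ (s n i) ^ 2
  let Q (n : ℕ) : ℝ :=
    ∑ i, w n i * ψ (s n i) * ∑ j, w n j * (K (s n i) (s n j) * ψ (s n j))
  have hP : Tendsto P atTop (𝓝 (∫ x, ψ x ^ 2 ∂m)) :=
    tendsto_sum_voronoiCell hmesh hdisj (g := fun x => ψ x ^ 2) (by fun_prop)
  have hA : Tendsto (fun n => ∑ i, w n i * |ψ (s n i)|) atTop (𝓝 (∫ x, |ψ x| ∂m)) :=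
    tendsto_sum_voronoiCell hmesh hdisj (g := fun x => |ψ x|) (by fun_prop)
  set B := ∫ x, |ψ x| ∂m
  have hB : 0 ≤ B := integral_nonneg fun x => abs_nonneg _
  have hdiff : Tendsto (fun n => Q n - lam * P n) atTop (𝓝 0) := by
    rw [Metric.tendsto_nhds]
    intro ε hε
    have hε' : 0 < ε / (2 * (B + 1)) := by positivity
    filter_upwards [eventually_abs_sum_voronoiCell_sub_integral_le hmesh hdisj
      (G := fun p : X × X => K p.1 p.2 * ψ p.2) (by fun_prop) hε',
      hA.eventually (gt_mem_nhds (lt_add_one B))] with n hn hAn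
    have : Q n - lam * P n = ∑ i, w n i * ψ (s n i) *
        (∑ j, w n j * (K (s n i) (s n j) * ψ (s n j)) - ∫ y, K (s n i) y * ψ y ∂m) := by
      simp only [Q, P, heig, mul_sub, Finset.sum_sub_distrib]
      rw [Finset.mul_sum]
      congr 1
      exact Finset.sum_congr rfl fun i _ => by ring
    rw [Real.dist_eq, sub_zero, this]
    calc _ ≤ ∑ i, w n i * |ψ (s n i)| * (ε / (2 * (B + 1))) := by
          refine (Finset.abs_sum_le_sum_abs _ _).trans (Finset.sum_le_sum fun i _ => ?_)
          rw [abs_mul, abs_mul, abs_of_nonneg (hw n i)]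
          exact mul_le_mul_of_nonneg_left (hn (s n i)) (mul_nonneg (hw n i) (abs_nonneg _))
      _ = (∑ i, w n i * |ψ (s n i)|) * (ε / (2 * (B + 1))) := by rw [Finset.sum_mul]
      _ ≤ (B + 1) * (ε / (2 * (B + 1))) := by gcongr
      _ = ε / 2 := by field_simp
      _ < ε := half_lt_self hε
  have hQ : Tendsto Q atTop (𝓝 (lam * ∫ x, ψ x ^ 2 ∂m)) := by
    have := hdiff.add (hP.const_mul lam)
    simpa using this
  refine ⟨fun n => Q n / (γ * m.real Set.univ * P n), ?_, ?_⟩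
  · have := hQ.div (hP.const_mul (γ * m.real Set.univ)) (by positivity)
    rw [mul_div_mul_right _ _ hψ0.ne'] at this
    rwa [one_div_mul_eq_div]
  filter_upwards [hP.eventually (lt_mem_nhds hψ0), eventually_ge_atTop 1] with n hPn hn
  have hn' : (0 : ℝ) < n := by exact_mod_cast hn
  set Λ := ithEigenvalue (hK.isHermitian_kernelMatrix (s n)) 1
  have hΛ : 0 ≤ Λ := ithEigenvalue_nonneg (hK.submatrix (s n)) 1
  let c (i : Fin n) : ℝ := w n i * ψ (s n i)
  have hQc : Q n = c ⬝ᵥ kernelMatrix K (s n) *ᵥ c := by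
    simp only [Q, c, dotProduct, mulVec, kernelMatrix, of_apply]
    refine Finset.sum_congr rfl fun i _ => ?_
    congr 1
    exact Finset.sum_congr rfl fun j _ => by ring
  have hwle (i : Fin n) : w n i ≤ γ * m.real Set.univ / n := by
    rw [le_div_iff₀ hn', ← sum_measureReal_voronoiCell hn (hdisj n), Finset.mul_sum, mul_comm]
    simpa using Finset.card_nsmul_le_sum Finset.univ
      (fun j => γ * m.real (voronoiCell (s n) j)) (w n i) fun j _ => hratio n i j
  have hcc : c ⬝ᵥ c ≤ γ * m.real Set.univ / n * P n := by
    simp only [c, dotProduct, P, Finset.mul_sum]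
    refine Finset.sum_le_sum fun i _ => ?_
    calc _ = w n i * (w n i * ψ (s n i) ^ 2) := by ring
      _ ≤ _ := mul_le_mul_of_nonneg_right (hwle i) (mul_nonneg (hw n i) (sq_nonneg _))
  rw [div_le_div_iff₀ (by positivity) hn']
  calc Q n * n ≤ Λ * (c ⬝ᵥ c) * n := by
        rw [hQc]
        gcongr
        exact dotProduct_mulVec_le_ithEigenvalue_one (hK.isHermitian_kernelMatrix (s n)) hn c
    _ ≤ Λ * (γ * m.real Set.univ / n * P n) * n := by gcongr
    _ = Λ * (γ * m.real Set.univ * P n) := by field_simp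

end VoronoiCells

/-! ### Lebesgue measure on a compact set -/

section LebesgueMeasure

variable {d : ℕ} {D : Set (EuclideanSpace ℝ (Fin d))}

theorem lebesgueOn_apply (hD : IsCompact D) (t : Set D) :
    lebesgueOn D t = volume (Subtype.val '' t) :=
  (MeasurableEmbedding.subtype_coe hD.measurableSet).comap_apply _ _

theorem lebesgueOn_univ (hD : IsCompact D) : lebesgueOn D Set.univ = volume D := by
  rw [lebesgueOn_apply hD, Set.image_univ, Subtype.range_coe]

theorem isFiniteMeasure_lebesgueOn (hD : IsCompact D) : IsFiniteMeasure (lebesgueOn D) :=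
  ⟨by rw [lebesgueOn_univ hD]; exact hD.measure_lt_top⟩

/-- Two Voronoi cells meet in a part of a bisecting hyperplane, which is a null set. -/
theorem aedisjoint_voronoiCell (hD : IsCompact D) {n : ℕ} {s : Fin n → D}
    (hs : Function.Injective s) :
    Pairwise (Function.onFun (AEDisjoint (lebesgueOn D)) (voronoiCell s)) := by
  intro i j hij
  have hne : (s i : EuclideanSpace ℝ (Fin d)) ≠ s j := fun h => hij (hs (Subtype.ext h))
  rw [Function.onFun, AEDisjoint, lebesgueOn_apply hD]
  refine measure_mono_null ?_ (Measure.addHaar_affineSubspace volume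
    (AffineSubspace.perpBisector (s i : EuclideanSpace ℝ (Fin d)) (s j))
    (by rwa [Ne, AffineSubspace.perpBisector_eq_top]))
  rintro _ ⟨x, ⟨hxi, hxj⟩, rfl⟩
  exact AffineSubspace.mem_perpBisector_iff_dist_eq.2 (le_antisymm (hxi j) (hxj i))

end LebesgueMeasure

/-! ### Covariance functions and their kernel matrices -/

section CovarianceFunctions

variable {X : Type*} {K : X → X → ℝ}

theorem IsCovarianceFunction.symm (hK : IsCovarianceFunction K) (x y : X) : K x y = K y x := by
  simpa using hK.isHermitian.apply y x

/-- A covariance function that vanishes on the diagonal vanishes identically, as the `2 × 2` kernel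
matrices have nonnegative determinants. -/
theorem IsCovarianceFunction.exists_pos_diag (hK : IsCovarianceFunction K)
    (hne : ∃ x y, K x y ≠ 0) : ∃ x, 0 < K x x := by
  obtain ⟨x, y, hxy⟩ := hne
  by_contra! h
  have hdet := (hK.submatrix ![x, y]).det_nonneg
  have hx : K x x = 0 := le_antisymm (h x) hK.diag_nonneg
  simp only [Matrix.det_fin_two, Matrix.submatrix_apply, Matrix.of_apply, Matrix.cons_val_zero,
    Matrix.cons_val_one, hx, hK.symm y x, zero_mul, zero_sub] at hdet
  have : 0 < K x y * K x y := mul_self_pos.2 hxy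
  linarith

/-- If the largest eigenvalue of the kernel matrix grows linearly, it dominates the `i`-th one,
which is at most `n M / i` for a kernel bounded by `M` on the diagonal. -/
theorem tendsto_div_ithEigenvalue (hK : IsCovarianceFunction K) {M : ℝ} (hM : ∀ x, K x x ≤ M)
    {s : ∀ n : ℕ, Fin n → X} {c : ℝ} (hc : 0 < c)
    (hlow : ∀ᶠ n : ℕ in atTop, c ≤ ithEigenvalue (hK.isHermitian_kernelMatrix (s n)) 1 / n)
    {i : ℕ → ℕ} (hin : ∀ n, i n ≤ n) (hi : Tendsto i atTop atTop) :
    Tendsto (fun n =>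
      ENNReal.ofReal (ithEigenvalue (hK.isHermitian_kernelMatrix (s n)) 1) /
        ENNReal.ofReal (ithEigenvalue (hK.isHermitian_kernelMatrix (s n)) (i n)))
      atTop (𝓝 ∞) := by
  -- `M` itself may vanish, and the quotient below needs a positive bound
  set M' := max M 1
  have hM' : 0 < M' := lt_max_of_lt_right one_pos
  have hlim : Tendsto (fun n => ENNReal.ofReal (c / M' * i n)) atTop (𝓝 ∞) :=
    ENNReal.tendsto_ofReal_atTop.comp
      ((tendsto_natCast_atTop_atTop.comp hi).const_mul_atTop (by positivity))
  refine tendsto_nhds_top_mono hlim ?_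
  filter_upwards [hlow, hi.eventually_ge_atTop 1, eventually_ge_atTop 1] with n hn hi1 hn1
  have hn' : (0 : ℝ) < n := by exact_mod_cast hn1
  have hi' : (0 : ℝ) < i n := by exact_mod_cast hi1
  rw [le_div_iff₀ hn'] at hn
  have htr : (kernelMatrix K (s n)).trace ≤ n * M' := by
    have := Finset.sum_le_card_nsmul Finset.univ (fun k : Fin n => K (s n k) (s n k)) M'
      fun k _ => (hM _).trans (le_max_left _ _)
    simpa [Matrix.trace, kernelMatrix] using this
  have hup : ithEigenvalue (hK.isHermitian_kernelMatrix (s n)) (i n) ≤ n * M' / i n := by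
    rw [le_div_iff₀ hi', mul_comm]
    exact (mul_ithEigenvalue_le_trace (hK.submatrix (s n)) hi1 (hin n)).trans htr
  calc ENNReal.ofReal (c / M' * i n) = ENNReal.ofReal (c * n / (n * M' / i n)) := by
        congr 1
        field_simp
    _ = ENNReal.ofReal (c * n) / ENNReal.ofReal (n * M' / i n) :=
        ENNReal.ofReal_div_of_pos (by positivity)
    _ ≤ _ := ENNReal.div_le_div (ENNReal.ofReal_le_ofReal hn) (ENNReal.ofReal_le_ofReal hup)

end CovarianceFunctions

theorem corollary1 {d : ℕ} (D : Set (EuclideanSpace ℝ (Fin d)))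
    (hD : IsCompact D) (hD_pos : 0 < volume D) (γ : ℝ) :
    ∃ a : ℝ, 0 < a ∧
      ∀ (K : D → D → ℝ) (hK : IsCovarianceFunction K)
        (_hK_cont : Continuous fun p : D × D => K p.1 p.2)
        (_hK_ne : ∃ x y, K x y ≠ 0)
        (s : ∀ n : ℕ, Fin n → D)
        (_hs_inj : ∀ n, Function.Injective (s n))
        (_hs_mesh : Tendsto (fun n => ⨆ i : Fin n, Metric.diam (voronoiCell (s n) i))
          atTop (𝓝 0))
        (_hs_ratio : ∀ (n : ℕ) (i j : Fin n),
          (lebesgueOn D).real (voronoiCell (s n) i) ≤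
            γ * (lebesgueOn D).real (voronoiCell (s n) j)),
        -- the ratio of the eigenvalues `λ_{n,1} / λ_{n,i}`, with value `∞` if `λ_{n,i} = 0 < λ_{n,1}`
        (∀ i : ℕ → ℕ, (∀ n, i n ≤ n) → Tendsto i atTop atTop →
          Tendsto (fun n =>
            ENNReal.ofReal (ithEigenvalue (hK.isHermitian_kernelMatrix (s n)) 1) /
              ENNReal.ofReal (ithEigenvalue (hK.isHermitian_kernelMatrix (s n)) (i n)))
            atTop (𝓝 ∞)) ∧
        -- the kernel matrix is ill-conditioned
        Tendsto (fun n => conditionNumber (kernelMatrix K (s n))) atTop (𝓝 ∞) ∧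
        -- so is the precision matrix, for those `n` for which it exists
        Tendsto (fun n => conditionNumber (kernelMatrix K (s n))⁻¹)
          (atTop ⊓ 𝓟 {n | IsUnit (kernelMatrix K (s n)).det}) (𝓝 ∞) ∧
        -- the asymptotic lower bound `λ_{n,1} / n ≥ a λ_1 + o(1)`
        ∃ lam₁ : ℝ, IsGreatest (integralEigenvalues (lebesgueOn D) K) lam₁ ∧ 0 < lam₁ ∧
          ∃ r : ℕ → ℝ, Tendsto r atTop (𝓝 0) ∧
            ∀ n : ℕ, 1 ≤ n →
              a * lam₁ + r n ≤ ithEigenvalue (hK.isHermitian_kernelMatrix (s n)) 1 / n := by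
  have := isFiniteMeasure_lebesgueOn hD
  have : CompactSpace D := isCompact_iff_compactSpace.1 hD
  set m := lebesgueOn D
  have hm : 0 < m.real Set.univ :=
    ENNReal.toReal_pos (by rw [lebesgueOn_univ hD]; exact hD_pos.ne') (measure_ne_top _ _)
  -- The case `n = 1` of the ratio condition forces `1 ≤ γ`; the maximum only serves to make the
  -- constant positive before any locations are given.
  set γ' := max γ 1
  have hγ' : 0 < γ' := lt_max_of_lt_right one_pos
  have ha : 0 < 1 / (γ' * m.real Set.univ) := by positivity
  refine ⟨1 / (γ' * m.real Set.univ), ha, ?_⟩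
  intro K hK hKc hKne s hs hmesh hratio₀
  have hratio (n : ℕ) (i j : Fin n) :
      m.real (voronoiCell (s n) i) ≤ γ' * m.real (voronoiCell (s n) j) :=
    (hratio₀ n i j).trans (mul_le_mul_of_nonneg_right (le_max_left _ _) measureReal_nonneg)
  have hdisj (n : ℕ) := aedisjoint_voronoiCell hD (hs n)
  have := isOpenPosMeasure_of_voronoiCell hm hmesh hdisj hratio
  obtain ⟨lam, hlam, hgreatest, ψ, hψ, hψ0, heig⟩ :=
    exists_isGreatest_integralEigenvalues (m := m) (K := ⟨fun p : D × D => K p.1 p.2, hKc⟩)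
      hK.symm (hK.exists_pos_diag hKne)
  obtain ⟨b, hb, hble⟩ := exists_tendsto_le_ithEigenvalue_one_div hK hKc hm hγ' hmesh hdisj
    hratio hψ hψ0 heig
  set a := 1 / (γ' * m.real Set.univ)
  obtain ⟨M, hM⟩ := isCompact_univ.bddAbove_image
    (f := fun x => K x x) (hKc.comp (continuous_id.prodMk continuous_id)).continuousOn
  have hpart1 {i : ℕ → ℕ} := tendsto_div_ithEigenvalue (i := i) hK
    (fun x => hM ⟨x, Set.mem_univ x, rfl⟩) (half_pos (mul_pos ha hlam))
    (by filter_upwards [hble, hb.eventually (lt_mem_nhds (half_lt_self (mul_pos ha hlam)))]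
          with n h1 h2 using h2.le.trans h1)
  have hcond : Tendsto (fun n => conditionNumber (kernelMatrix K (s n))) atTop (𝓝 ∞) := by
    refine tendsto_nhds_top_mono (hpart1 (i := id) (fun n => le_rfl) tendsto_id) ?_
    filter_upwards [eventually_ge_atTop 1] with n hn
    exact div_ithEigenvalue_le_conditionNumber (hK.submatrix (s n)) hn
  refine ⟨fun i hin hi => hpart1 hin hi, hcond, ?_, lam, hgreatest, hlam, ?_⟩
  · refine (hcond.mono_left inf_le_left).congr' ?_
    filter_upwards [mem_inf_of_right (mem_principal_self _)] with n hn
    exact (conditionNumber_inv hn).symm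
  · refine ⟨fun n => min (b n - a * lam)
      (ithEigenvalue (hK.isHermitian_kernelMatrix (s n)) 1 / n - a * lam), ?_, fun n _ => ?_⟩
    · refine Tendsto.congr' (f₁ := fun n => b n - a * lam) ?_ ?_
      · filter_upwards [hble] with n hn
        exact (min_eq_left (sub_le_sub_right hn _)).symm
      · simpa using hb.sub_const (a * lam)
    · linarith [min_le_right (b n - a * lam)
        (ithEigenvalue (hK.isHermitian_kernelMatrix (s n)) 1 / n - a * lam)]
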